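/- Let $K$ be a number field, let $m\ge 0$, and let $q,\xi,\alpha_1,\dots,\alpha_m,\beta_0,\beta_1,\dots,\beta_m$ be elements of $K$. Assume that $q,\xi,\alpha_1,\dots,\alpha_m$ are nonzero, that $q$ is not a root of unity, and that the classes of $\alpha_1,\dots,\alpha_m$ in $K^*/q^{\mathbb Z}$ are pairwise distinct. For every place $v$ of $K$ (archimedean or not) with $|q|_v>1$, let $$T_q(z)=\sum_{n\ge 0} q^{-n(n-1)/2}z^n$$ denote the Tschakaloff function, regarded as an entire function on the completion $K_v$ of $K$ at $v$. Suppose that for every place $v$ of $K$ such that $|q|_v>1$, the $v$-adic function $$\beta_0+\beta_1T_q(\alpha_1z)+\dots+\beta_mT_q(\alpha_mz)$$ vanishes at $\xi$, that is, $\beta_0+\sum_{i=1}^m\beta_iT_q(\alpha_i\xi)=0$ in $K_v$. Then $\beta_0=\beta_1=\dots=\beta_m=0$. -/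

import Mathlib

/-- The coefficient `q^{-n(n-1)/2}` of `z^n` in the Tschakaloff series. The division of natural
numbers is exact, and the value at `n = 0` is `1`. -/
noncomputable def tschakaloffCoeff {L : Type*} [Field L] (q : L) (n : ℕ) : L :=
  (q ^ (n * (n - 1) / 2))⁻¹

/-- The Tschakaloff function `T_q(z) = ∑_{n ≥ 0} q^{-n(n-1)/2} z^n` over a topological field.
Over a complete normed field it is an entire function of `z` as soon as `|q| > 1`
(see `summable_tschakaloff`). -/
noncomputable def tschakaloff {L : Type*} [Field L] [TopologicalSpace L] (q z : L) : L :=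
  ∑' n : ℕ, tschakaloffCoeff q n * z ^ n

/-- If `|q| > 1`, the series which defines `T_q(z)` converges for every `z`. -/
theorem summable_tschakaloff {L : Type*} [NormedField L] [CompleteSpace L] (q z : L)
    (hq : 1 < ‖q‖) : Summable fun n : ℕ => tschakaloffCoeff q n * z ^ n := by
  have hq0 : q ≠ 0 := norm_pos_iff.1 (one_pos.trans hq)
  have step : ∀ n : ℕ, (n + 1) * (n + 1 - 1) / 2 = n * (n - 1) / 2 + n := by
    intro n
    rw [← Nat.choose_two_right, ← Nat.choose_two_right, Nat.choose_succ_succ' n 1]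
    simp [add_comm]
  have hlim : Filter.Tendsto (fun n : ℕ => (‖q‖⁻¹) ^ n * ‖z‖) Filter.atTop (nhds 0) := by
    simpa using (tendsto_pow_atTop_nhds_zero_of_lt_one (by positivity)
      (inv_lt_one_of_one_lt₀ hq)).mul_const ‖z‖
  refine summable_of_ratio_norm_eventually_le (r := 1 / 2) (by norm_num) ?_
  filter_upwards [hlim.eventually (ge_mem_nhds (show (0 : ℝ) < 1 / 2 by norm_num))] with n hn
  have : tschakaloffCoeff q (n + 1) * z ^ (n + 1)
      = (q⁻¹ ^ n * z) * (tschakaloffCoeff q n * z ^ n) := by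
    unfold tschakaloffCoeff
    rw [step, pow_add, mul_inv, inv_pow, pow_succ]
    ring
  rw [this, norm_mul]
  refine mul_le_mul_of_nonneg_right ?_ (norm_nonneg _)
  simpa using hn

/-- The canonical embedding of `K` into its completion `K_v` at an absolute value `v`. -/
noncomputable def toCompletion {K : Type*} [Field K] (v : AbsoluteValue K ℝ) :
    K →+* v.Completion :=
  UniformSpace.Completion.coeRingHom.comp (WithAbs.equiv v).symm.toRingHom

theorem norm_toCompletion {K : Type*} [Field K] (v : AbsoluteValue K ℝ) (x : K) :
    ‖toCompletion v x‖ = v x := by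
  exact (UniformSpace.Completion.norm_coe (WithAbs.toAbs v x)).trans rfl

/-- The series which defines `T_q(z)` on `K_v` converges for every `z` whenever `|q|_v > 1`. -/
theorem summable_tschakaloff_completion {K : Type*} [Field K] (v : AbsoluteValue K ℝ)
    (q : K) (hq : 1 < v q) (z : v.Completion) :
    Summable fun n : ℕ => tschakaloffCoeff (toCompletion v q) n * z ^ n :=
  summable_tschakaloff _ z (by rwa [norm_toCompletion])

/-- The `v`-adic function `z ↦ β₀ + ∑ᵢ βᵢ T_q(αᵢ z)` on `K_v`, for `q, αᵢ, βⱼ` in `K`. -/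
noncomputable def tschakaloffComb {K : Type*} [Field K] (v : AbsoluteValue K ℝ) {m : ℕ}
    (q : K) (α : Fin m → K) (β₀ : K) (β : Fin m → K) (z : v.Completion) : v.Completion :=
  toCompletion v β₀ +
    ∑ i, toCompletion v (β i) * tschakaloff (toCompletion v q) (toCompletion v (α i) * z)

/-!
The argument follows the pattern of the Borel–Dwork rationality criterion.

Put `γᵢ = αᵢ ξ` and let `b_N` be the partial sum `∑_{n < N}` of `β₀ + ∑ᵢ βᵢ T_q(γᵢ)`, multiplied by
`q ^ (N (N - 1) / 2)`, so that `b_{N+1} = q ^ N (b_N + ∑ᵢ βᵢ γᵢ ^ N)`. At the places with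
`|q| ≤ 1` this recurrence bounds `b_N` by a geometric sequence; at the places with `|q| > 1` the
vanishing hypothesis turns the partial sum into a tail, and `b_N` is again bounded by a geometric
sequence (`toCompletion_scaledPartialSum`). So the generating series `F(z) = ∑ b_N z ^ N` has a
positive radius of convergence at every place, and integral coefficients at almost all finite ones.

The recurrence is a `q`-difference equation `F(z) = β₀ + z F(q z) + z ∑ᵢ βᵢ / (1 - q γᵢ z)`. At a
place with `|q| < 1`, iterating it continues `F` to a meromorphic function on the whole plane
(`exists_monic_forall_abv_le`), and so the Hankel determinants `det (b_{i+j})_{i,j<n}` decay there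
faster than every `ε ^ (n ^ 2)`; at the other places they are at most `C ^ (n ^ 2)`, with `C = 1`
for almost all places. Since `q` is not a root of unity, a place with `|q| < 1` exists, and the
product formula forces the determinants to vanish for large `n`
(`eventually_det_hankelMatrix_eq_zero`). By Kronecker's criterion
(`exists_annihilator_of_det_hankelMatrix`) the sequence `b` satisfies a linear recurrence, that is,
`F` is rational.

A rational solution exists only in the trivial case (`eq_zero_of_annihilator`): `F(z) - z F(q z)`
has either no poles or at least two poles on each orbit of multiplication by `q`, whereas the
inhomogeneous term has one pole on the orbit of `1 / γᵢ` if `βᵢ ≠ 0`, because the `αᵢ` are in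
distinct classes modulo `q ^ ℤ`. Hence `β = 0`, and then `b_N = q ^ (N (N - 1) / 2) β₀` satisfies a
linear recurrence only if `β₀ = 0`.

Instead of power series, the proof uses the functional `φ` on `K[X]` with `φ (X ^ n) = b_n`, for
which the `q`-difference equation reads `φ (X p) = φ (p (q X)) + ∑ᵢ βᵢ p (q γᵢ)`, and a linear
recurrence with characteristic polynomial `A` means that `φ` vanishes on the multiples of `A`.
-/

open Polynomial

/-! ### Linear functionals on polynomials and their Hankel determinants -/

/-- The linear functional on `K[X]` which sends `X ^ n` to `b n`. The shift of the sequence `b`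
becomes multiplication by `X` in the argument. -/
noncomputable def momentFunctional {K : Type*} [Field K] (b : ℕ → K) : K[X] →ₗ[K] K :=
  Polynomial.lsum fun n => LinearMap.toSpanSingleton K K (b n)

theorem momentFunctional_monomial {K : Type*} [Field K] (b : ℕ → K) (n : ℕ) (a : K) :
    momentFunctional b (monomial n a) = a * b n := by
  simp [momentFunctional, Polynomial.lsum_apply, sum_monomial_index]

theorem momentFunctional_X_pow {K : Type*} [Field K] (b : ℕ → K) (n : ℕ) :
    momentFunctional b (X ^ n) = b n := by
  rw [← monomial_one_right_eq_X_pow, momentFunctional_monomial, one_mul]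

/-- The `n × n` Hankel matrix of the moments `φ (X ^ k)` of a linear functional. -/
noncomputable def hankelMatrix {K : Type*} [Field K] (φ : K[X] →ₗ[K] K) (n : ℕ) :
    Matrix (Fin n) (Fin n) K :=
  Matrix.of fun i j => φ (X ^ (i + j : ℕ))

theorem map_mul_eq_zero_of_forall_X_pow {K : Type*} [Field K] (φ : K[X] →ₗ[K] K) {n : ℕ}
    {p : K[X]} (h : ∀ i < n, φ (p * X ^ i) = 0) {g : K[X]} (hg : g.degree < n) :
    φ (p * g) = 0 := by
  by_cases hg0 : g = 0
  · simp [hg0]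
  rw [g.as_sum_range_C_mul_X_pow' ((natDegree_lt_iff_degree_lt hg0).2 hg), Finset.mul_sum, map_sum]
  refine Finset.sum_eq_zero fun i hi => ?_
  rw [mul_left_comm, ← smul_eq_C_mul, map_smul, h i (Finset.mem_range.1 hi), smul_zero]

/-- The Hankel determinant vanishes exactly when the bilinear form `(p, g) ↦ φ (p * g)` is
degenerate on polynomials of degree less than `n`. -/
theorem det_hankelMatrix_eq_zero_iff {K : Type*} [Field K] (φ : K[X] →ₗ[K] K) (n : ℕ) :
    (hankelMatrix φ n).det = 0 ↔
      ∃ p : K[X], p ≠ 0 ∧ p.degree < n ∧ ∀ g : K[X], g.degree < n → φ (p * g) = 0 := by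
  have key : ∀ (p : K[X]), p.degree < n → ∀ i : Fin n,
      φ (p * X ^ (i : ℕ)) = (hankelMatrix φ n).mulVec (fun j => p.coeff j) i := by
    intro p hp i
    by_cases hp0 : p = 0
    · simp [hp0, Matrix.mulVec, dotProduct]
    conv_lhs => rw [p.as_sum_range_C_mul_X_pow' ((natDegree_lt_iff_degree_lt hp0).2 hp)]
    rw [Finset.sum_mul, map_sum, Finset.sum_range]
    refine Finset.sum_congr rfl fun j _ => ?_
    rw [mul_assoc, ← smul_eq_C_mul, map_smul, ← pow_add, smul_eq_mul, mul_comm]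
    simp [hankelMatrix, add_comm]
  rw [← Matrix.exists_mulVec_eq_zero_iff]
  constructor
  · rintro ⟨v, hv, hM⟩
    have hco : (fun j : Fin n => ((degreeLTEquiv K n).symm v : K[X]).coeff j) = v :=
      (degreeLTEquiv K n).apply_symm_apply v
    have hdeg := mem_degreeLT.1 ((degreeLTEquiv K n).symm v).2
    refine ⟨((degreeLTEquiv K n).symm v : K[X]), ?_, hdeg, fun g hg => ?_⟩
    · simpa using hv
    · refine map_mul_eq_zero_of_forall_X_pow φ (fun i hi => ?_) hg
      rw [key _ hdeg ⟨i, hi⟩, hco, hM, Pi.zero_apply]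
  · rintro ⟨p, hp, hdeg, h⟩
    refine ⟨fun j => p.coeff j, fun h0 => hp ?_, funext fun i => ?_⟩
    · ext k
      by_cases hk : k < n
      · exact congrFun h0 ⟨k, hk⟩
      · exact coeff_eq_zero_of_degree_lt (hdeg.trans_le (by exact_mod_cast not_lt.1 hk))
    · rw [← key p hdeg i, Pi.zero_apply]
      exact h _ (by rw [degree_X_pow]; exact_mod_cast i.2)

/-- **Kronecker's criterion**: if almost all Hankel determinants of `φ` vanish, then the moments
of `φ` satisfy a linear recurrence, with characteristic polynomial `A`. -/
theorem exists_annihilator_of_det_hankelMatrix {K : Type*} [Field K] (φ : K[X] →ₗ[K] K)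
    (h : ∀ᶠ n in Filter.atTop, (hankelMatrix φ n).det = 0) :
    ∃ A : K[X], A ≠ 0 ∧ ∀ g, φ (A * g) = 0 := by
  classical
  -- `r` is the largest size of a nonsingular Hankel matrix
  obtain ⟨r, hr, hmax⟩ : ∃ r, (hankelMatrix φ r).det ≠ 0 ∧
      ∀ n, r < n → (hankelMatrix φ n).det = 0 := by
    have hex := Filter.eventually_atTop.1 h
    have hspec := Nat.find_spec hex
    rcases hn : Nat.find hex with _ | r
    · rw [hn] at hspec
      have := hspec 0 le_rfl
      simp [Matrix.det_isEmpty] at this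
    · rw [hn] at hspec
      refine ⟨r, fun h0 => ?_, fun n hn' => hspec n hn'⟩
      refine Nat.find_min hex (m := r) (by omega) fun n hn' => ?_
      rcases hn'.eq_or_lt with rfl | hlt
      · exact h0
      · exact hspec n hlt
  obtain ⟨A, hA0, hAdeg, hA⟩ := (det_hankelMatrix_eq_zero_iff φ (r + 1)).1 (hmax _ r.lt_succ_self)
  have hAr : A.natDegree = r := by
    have h1 : A.natDegree < r + 1 := (natDegree_lt_iff_degree_lt hA0).2 hAdeg
    by_contra hne
    refine hr ((det_hankelMatrix_eq_zero_iff φ r).2 ⟨A, hA0, ?_, fun g hg => hA g ?_⟩)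
    · exact (natDegree_lt_iff_degree_lt hA0).1 (by omega)
    · exact hg.trans (by exact_mod_cast r.lt_succ_self)
  have hAX : ∀ s, φ (A * X ^ s) = 0 := by
    intro s
    induction s using Nat.strong_induction_on with
    | _ s ih =>
    by_contra hs
    have hrs : r < s := by
      by_contra hle
      refine hs (hA _ ?_)
      rw [degree_X_pow]
      exact_mod_cast (show s < r + 1 by omega)
    -- the Hankel matrix of size `s + 1` would be nonsingular
    obtain ⟨x, hx0, hxdeg, hx⟩ := (det_hankelMatrix_eq_zero_iff φ (s + 1)).1 (hmax _ (by omega))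
    have hdm := EuclideanDomain.div_add_mod x A
    have hmod : (x % A).degree < r := by
      have := EuclideanDomain.mod_lt x hA0
      rwa [← hAr, ← degree_eq_natDegree hA0]
    have hxnat : x.natDegree < s + 1 := (natDegree_lt_iff_degree_lt hx0).2 hxdeg
    have hu : x / A ≠ 0 → r + (x / A).natDegree = x.natDegree := by
      intro hu0
      have h1 := degree_add_div hA0 (not_lt.1 fun h => hu0 ((Polynomial.div_eq_zero_iff hA0).2 h))
      rw [degree_eq_natDegree hA0, degree_eq_natDegree hu0, degree_eq_natDegree hx0, hAr] at h1
      exact_mod_cast h1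
    have hv : x % A = 0 := by
      by_contra hv0
      refine hr ((det_hankelMatrix_eq_zero_iff φ r).2 ⟨_, hv0, hmod, fun g hg => ?_⟩)
      by_cases hg0 : g = 0
      · simp [hg0]
      have h1 : φ (A * ((x / A) * g)) = 0 := by
        by_cases hu0 : x / A = 0
        · simp [hu0]
        refine map_mul_eq_zero_of_forall_X_pow φ ih ?_
        rw [← natDegree_lt_iff_degree_lt (mul_ne_zero hu0 hg0), natDegree_mul hu0 hg0]
        have := hu hu0
        have := (natDegree_lt_iff_degree_lt hg0).2 hg
        omega
      have h2 : φ (x * g) = 0 := hx g (hg.trans (by exact_mod_cast (show r < s + 1 by omega)))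
      rw [← hdm, add_mul, mul_assoc, map_add, h1, zero_add] at h2
      exact h2
    rw [hv, add_zero] at hdm
    have hu0 : x / A ≠ 0 := fun h0 => hx0 (by rw [← hdm, h0, mul_zero])
    have hxA := hu hu0
    set u := x / A
    have hd : u.natDegree ≤ s := by omega
    -- testing against `X ^ (s - deg u)` isolates the leading coefficient of the quotient `u`
    have h3 : φ (x * X ^ (s - u.natDegree)) = 0 := by
      refine hx _ ?_
      rw [degree_X_pow]
      exact_mod_cast (show s - u.natDegree < s + 1 by omega)
    rw [← hdm, mul_assoc, ← u.eraseLead_add_C_mul_X_pow, add_mul, mul_add, map_add] at h3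
    rw [u.eraseLead_add_C_mul_X_pow] at h3
    have h4 : φ (A * (u.eraseLead * X ^ (s - u.natDegree))) = 0 := by
      by_cases he : u.eraseLead = 0
      · simp [he]
      refine map_mul_eq_zero_of_forall_X_pow φ ih ?_
      rw [← natDegree_lt_iff_degree_lt (mul_ne_zero he (pow_ne_zero _ X_ne_zero)),
        natDegree_mul he (pow_ne_zero _ X_ne_zero), natDegree_X_pow]
      have := natDegree_lt_natDegree he (degree_eraseLead_lt hu0)
      omega
    rw [h4, zero_add, mul_assoc, ← pow_add, Nat.add_sub_cancel' hd, mul_left_comm,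
      ← smul_eq_C_mul, map_smul, smul_eq_mul] at h3
    exact (mul_ne_zero (leadingCoeff_ne_zero.2 hu0) hs) h3
  refine ⟨A, hA0, fun g => ?_⟩
  exact map_mul_eq_zero_of_forall_X_pow φ (n := g.natDegree + 1) (fun i _ => hAX i)
    (degree_le_natDegree.trans_lt (by exact_mod_cast g.natDegree.lt_succ_self))

/-- Replacing the powers of `X` that index the rows by monic polynomials of the same degrees does
not change the Hankel determinant. -/
theorem det_hankelMatrix_eq_of_monic {K : Type*} [Field K] (φ : K[X] →ₗ[K] K) {n : ℕ}
    (f : Fin n → K[X]) (hf : ∀ i, (f i).Monic) (hdeg : ∀ i, (f i).natDegree = i) :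
    (hankelMatrix φ n).det = (Matrix.of fun i j : Fin n => φ (f i * X ^ (j : ℕ))).det := by
  have : (Matrix.of fun i j : Fin n => φ (f i * X ^ (j : ℕ)))
      = (Matrix.of fun i j : Fin n => (f j).coeff i).transpose * hankelMatrix φ n := by
    ext i j
    rw [Matrix.mul_apply, Matrix.of_apply,
      (f i).as_sum_range_C_mul_X_pow' (show (f i).natDegree < n from hdeg i ▸ i.2),
      Finset.sum_mul, map_sum, Finset.sum_range]
    refine Finset.sum_congr rfl fun k _ => ?_
    rw [mul_assoc, ← smul_eq_C_mul, map_smul, ← pow_add, smul_eq_mul]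
    rfl
  rw [this, Matrix.det_mul, Matrix.det_transpose, Matrix.det_matrixOfPolynomials f hdeg hf, one_mul]

/-! ### Rational solutions of the `q`-difference equation -/

theorem eq_zero_of_forall_eval_mul_pow {K : Type*} [Field K] {A : K[X]} {x c : K} (hx : x ≠ 0)
    (hc0 : c ≠ 0) (hc : ∀ n : ℕ, 0 < n → c ^ n ≠ 1) (h : ∀ n : ℕ, A.eval (x * c ^ n) = 0) :
    A = 0 := by
  have hinj : Function.Injective fun n : ℕ => x * c ^ n := by
    have : ∀ a d : ℕ, x * c ^ a = x * c ^ (a + d) → d = 0 := by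
      intro a d had
      by_contra hd
      refine hc d (Nat.pos_of_ne_zero hd) ?_
      have := mul_left_cancel₀ hx had
      rw [pow_add] at this
      exact (mul_eq_left₀ (pow_ne_zero a hc0)).1 this.symm
    intro a b hab
    rcases le_total a b with hle | hle <;> obtain ⟨d, rfl⟩ := Nat.exists_eq_add_of_le hle
    · simp [this a d hab]
    · simp [this b d hab.symm]
  refine eq_zero_of_infinite_isRoot A ((Set.infinite_range_of_injective hinj).mono ?_)
  rintro _ ⟨n, rfl⟩
  exact h n

/-- A solution `φ` of the homogeneous equation `φ (X p) = φ (p (q X))` has the moments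
`q ^ (j (j - 1) / 2) * φ 1`, which satisfy no linear recurrence unless they vanish. -/
theorem map_one_eq_zero_of_annihilator {K : Type*} [Field K] {q : K} (hq : q ≠ 0)
    (hq_root : ∀ n : ℕ, 0 < n → q ^ n ≠ 1) (φ : K[X] →ₗ[K] K)
    (hφ : ∀ p : K[X], φ (X * p) = φ (p.comp (C q * X)))
    (hA : ∃ A : K[X], A ≠ 0 ∧ ∀ g, φ (A * g) = 0) : φ 1 = 0 := by
  obtain ⟨A, hA0, hAφ⟩ := hA
  by_contra h1
  have hmom : ∀ j, φ (X ^ j) ≠ 0 := by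
    intro j
    induction j with
    | zero => simpa using h1
    | succ j ih =>
      rw [pow_succ', hφ, X_pow_comp, mul_pow, ← C_pow, ← smul_eq_C_mul, map_smul, smul_eq_mul]
      exact mul_ne_zero (pow_ne_zero _ hq) ih
  have hshift : ∀ n : ℕ, ∃ c : K, c ≠ 0 ∧
      ∀ p : K[X], φ (X ^ n * p) = c * φ (p.comp (C (q ^ n) * X)) := by
    intro n
    induction n with
    | zero => exact ⟨1, one_ne_zero, fun p => by simp⟩
    | succ n ih =>
      obtain ⟨c, hc, h⟩ := ih
      refine ⟨q ^ n * c, mul_ne_zero (pow_ne_zero _ hq) hc, fun p => ?_⟩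
      rw [pow_succ', mul_assoc, hφ, mul_comp, X_pow_comp, mul_pow, ← C_pow, mul_assoc,
        ← smul_eq_C_mul, map_smul, smul_eq_mul, h, comp_assoc, mul_comp, C_comp, X_comp,
        ← mul_assoc (C q), ← C_mul, ← pow_succ', mul_assoc]
  let D : K[X] := ∑ j ∈ Finset.range (A.natDegree + 1), C (A.coeff j * φ (X ^ j)) * X ^ j
  have hD : D = 0 := by
    refine eq_zero_of_forall_eval_mul_pow one_ne_zero hq hq_root fun n => ?_
    obtain ⟨c, hc, h⟩ := hshift n
    have h2 := h A
    rw [mul_comm, hAφ, eq_comm, mul_eq_zero, or_iff_right hc] at h2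
    rw [← h2]
    conv_rhs => rw [A.as_sum_range_C_mul_X_pow]
    rw [← coe_compRingHom_apply, map_sum, map_sum]
    simp only [D, eval_finsetSum, one_mul]
    refine Finset.sum_congr rfl fun j _ => ?_
    simp only [eval_mul, eval_C, eval_pow, eval_X]
    rw [coe_compRingHom_apply, mul_comp, C_comp, X_pow_comp, mul_pow, ← C_pow, ← mul_assoc,
      ← C_mul, ← smul_eq_C_mul, map_smul, smul_eq_mul]
    ring
  have hlead : D.coeff A.natDegree = A.leadingCoeff * φ (X ^ A.natDegree) := by
    simp only [D, finsetSum_coeff, coeff_C_mul_X_pow]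
    rw [Finset.sum_ite_eq]
    simp
  rw [hD, coeff_zero] at hlead
  exact mul_ne_zero (leadingCoeff_ne_zero.2 hA0) (hmom _) hlead.symm

/-- A functional `φ` whose generating series satisfies the inhomogeneous `q`-difference equation
`φ (X p) = φ (p (q X)) + ∑ βᵢ p (δᵢ)`, with `δᵢ` in distinct classes modulo `q ^ ℤ`, and whose
moments satisfy a linear recurrence, has `β = 0` and `φ 1 = 0`.

Let `A` be the minimal characteristic polynomial of the recurrence. A root `δᵢ q ^ k` of `A` forces
the root `δᵢ q ^ (k + 1)` unless `k = -1`, and the root `δᵢ q ^ (k - 1)` unless `k = 0`. If `βᵢ ≠ 0`,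
then `k = 0` or `k = -1` gives a root, from which infinitely many follow. -/
theorem eq_zero_of_annihilator {K : Type*} [Field K] {m : ℕ} {q : K} {δ β : Fin m → K}
    (hq : q ≠ 0) (hq_root : ∀ n : ℕ, 0 < n → q ^ n ≠ 1) (hδ0 : ∀ i, δ i ≠ 0)
    (hδ : ∀ i j (k : ℤ), δ i * q ^ k = δ j → i = j) (φ : K[X] →ₗ[K] K)
    (hφ : ∀ p : K[X], φ (X * p) = φ (p.comp (C q * X)) + ∑ i, β i * p.eval (δ i))
    (hA : ∃ A : K[X], A ≠ 0 ∧ ∀ g, φ (A * g) = 0) :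
    (∀ i, β i = 0) ∧ φ 1 = 0 := by
  classical
  let I : Ideal K[X] :=
    { carrier := {A | ∀ g, φ (A * g) = 0}
      add_mem' := fun {a b} ha hb g => by rw [add_mul, map_add, ha g, hb g, add_zero]
      zero_mem' := fun g => by rw [zero_mul, map_zero]
      smul_mem' := fun c a ha g => by
        rw [smul_eq_mul, mul_comm c a, mul_assoc]; exact ha _ }
  have hI : ∀ a, a ∈ I ↔ ∀ g, φ (a * g) = 0 := fun a => Iff.rfl
  obtain ⟨A, hAI⟩ : ∃ A, I = Ideal.span {A} := (IsPrincipalIdealRing.principal I).principal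
  have hdvd : ∀ {a}, (∀ g, φ (a * g) = 0) → A ∣ a := by
    intro a ha
    rwa [← hI, hAI, Ideal.mem_span_singleton] at ha
  have hAφ : ∀ g, φ (A * g) = 0 := by
    rw [← hI, hAI]
    exact Ideal.mem_span_singleton_self A
  have hA0 : A ≠ 0 := by
    rintro rfl
    obtain ⟨a, ha0, ha⟩ := hA
    exact ha0 (zero_dvd_iff.1 (hdvd ha))
  have hqinv : ∀ p : K[X], (p.comp (C q⁻¹ * X)).comp (C q * X) = p := by
    intro p
    rw [comp_assoc, mul_comp, C_comp, X_comp, ← mul_assoc, ← C_mul, inv_mul_cancel₀ hq, C_1,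
      one_mul, comp_X]
  have hqinv' : ∀ p : K[X], (p.comp (C q * X)).comp (C q⁻¹ * X) = p := by
    intro p
    rw [comp_assoc, mul_comp, C_comp, X_comp, ← mul_assoc, ← C_mul, mul_inv_cancel₀ hq, C_1,
      one_mul, comp_X]
  have hqz : ∀ k : ℤ, q ^ k = 1 → k = 0 := by
    intro k hk
    by_contra hk0
    refine hq_root k.natAbs (Int.natAbs_pos.2 hk0) ?_
    rcases Int.natAbs_eq k with h | h
    · rw [h, zpow_natCast] at hk
      exact hk
    · rw [h, zpow_neg, zpow_natCast, inv_eq_one] at hk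
      exact hk
  -- `B` kills the inhomogeneous term
  let B : K[X] := ∏ i with β i ≠ 0, (X - C (δ i))
  have hBsum : ∀ p : K[X], ∑ i, β i * (p * B).eval (δ i) = 0 := by
    intro p
    refine Finset.sum_eq_zero fun i _ => ?_
    by_cases hi : β i = 0
    · rw [hi, zero_mul]
    · have : B.eval (δ i) = 0 := by
        rw [eval_prod]
        exact Finset.prod_eq_zero (Finset.mem_filter.2 ⟨Finset.mem_univ i, hi⟩) (by simp)
      rw [eval_mul, this, mul_zero, mul_zero]
  have hBroot : ∀ (i) (k : ℤ), B.eval (δ i * q ^ k) = 0 → k = 0 := by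
    intro i k hk
    rw [eval_prod, Finset.prod_eq_zero_iff] at hk
    obtain ⟨j, -, hj⟩ := hk
    rw [eval_sub, eval_X, eval_C, sub_eq_zero] at hj
    obtain rfl := hδ i j k hj
    exact hqz k ((mul_eq_left₀ (hδ0 i)).1 hj)
  -- roots of `A` on an orbit propagate upwards by `hup` and downwards by `hdown`
  have hup : A ∣ A.comp (C q * X) * B.comp (C q * X) := by
    refine hdvd fun g => ?_
    have h1 := hφ (A * g.comp (C q⁻¹ * X) * B)
    rw [hBsum, add_zero, mul_comp, mul_comp, hqinv,
      show X * (A * g.comp (C q⁻¹ * X) * B) = A * (X * g.comp (C q⁻¹ * X) * B) by ring, hAφ] at h1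
    rw [h1]
    congr 1
    ring
  have hdown : A ∣ X * A.comp (C q⁻¹ * X) * B := by
    refine hdvd fun g => ?_
    rw [show X * A.comp (C q⁻¹ * X) * B * g = X * (A.comp (C q⁻¹ * X) * g * B) by ring, hφ, hBsum,
      add_zero, mul_comp, mul_comp, hqinv, mul_assoc, hAφ]
  -- the pole of the inhomogeneous term at `δ i` has to come from `φ`
  have hpole : ∀ i, β i ≠ 0 → A.eval (δ i) = 0 ∨ A.eval (q⁻¹ * δ i) = 0 := by
    intro i hi
    -- a polynomial that separates `δ i` from the other `δ j`
    let g : K[X] := ∏ j ∈ Finset.univ.erase i, (X - C (δ j))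
    have h1 := hφ (A * A.comp (C q⁻¹ * X) * g)
    rw [show X * (A * A.comp (C q⁻¹ * X) * g) = A * (X * A.comp (C q⁻¹ * X) * g) by ring, hAφ,
      mul_comp, mul_comp, hqinv, mul_comm _ A, mul_assoc, hAφ, zero_add,
      Finset.sum_eq_single i] at h1
    · have hg : g.eval (δ i) ≠ 0 := by
        rw [eval_prod, Finset.prod_ne_zero_iff]
        intro j hj
        rw [eval_sub, eval_X, eval_C, sub_ne_zero]
        intro hij
        exact (Finset.ne_of_mem_erase hj) (hδ i j 0 (by simpa using hij)).symm
      have h2 := (mul_eq_zero.1 h1.symm).resolve_left hi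
      rw [eval_mul, eval_mul, eval_comp] at h2
      simpa [hg] using h2
    · intro j _ hj
      have : g.eval (δ j) = 0 := by
        rw [eval_prod]
        exact Finset.prod_eq_zero (Finset.mem_erase.2 ⟨hj, Finset.mem_univ j⟩) (by simp)
      rw [eval_mul, this, mul_zero, mul_zero]
    · simp
  have hβ : ∀ i, β i = 0 := by
    intro i
    by_contra hi
    rcases hpole i hi with h | h
    · refine hA0 (eq_zero_of_forall_eval_mul_pow (hδ0 i) hq hq_root fun n => ?_)
      induction n with
      | zero => simpa using h
      | succ n ih =>
        have h1 := eval_dvd hup (x := δ i * q ^ n)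
        rw [ih, zero_dvd_iff, eval_mul, eval_comp, eval_comp] at h1
        have h2 : (C q * X : K[X]).eval (δ i * q ^ n) = δ i * q ^ (n + 1) := by
          simp only [eval_mul, eval_C, eval_X]; ring
        rw [h2] at h1
        refine (mul_eq_zero.1 h1).resolve_right fun hB => ?_
        have := hBroot i ((n + 1 : ℕ) : ℤ) (by rw [zpow_natCast]; exact hB)
        omega
    · have hq_root' : ∀ n : ℕ, 0 < n → q⁻¹ ^ n ≠ 1 := by
        intro n hn h1
        exact hq_root n hn (by rwa [inv_pow, inv_eq_one] at h1)
      refine hA0 (eq_zero_of_forall_eval_mul_pow (x := q⁻¹ * δ i)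
        (mul_ne_zero (inv_ne_zero hq) (hδ0 i)) (inv_ne_zero hq) hq_root' fun n => ?_)
      induction n with
      | zero => simpa using h
      | succ n ih =>
        have h1 := eval_dvd hdown (x := q⁻¹ * δ i * q⁻¹ ^ n)
        rw [ih, zero_dvd_iff, eval_mul, eval_mul, eval_comp, eval_X] at h1
        have h2 : (C q⁻¹ * X : K[X]).eval (q⁻¹ * δ i * q⁻¹ ^ n) = q⁻¹ * δ i * q⁻¹ ^ (n + 1) := by
          simp only [eval_mul, eval_C, eval_X]; ring
        rw [h2] at h1
        rcases mul_eq_zero.1 h1 with h1 | hB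
        · exact (mul_eq_zero.1 h1).resolve_left (mul_ne_zero (mul_ne_zero (inv_ne_zero hq) (hδ0 i))
            (pow_ne_zero _ (inv_ne_zero hq)))
        · have := hBroot i (-((n + 1 : ℕ) : ℤ)) (by
            rw [zpow_neg, zpow_natCast, ← inv_pow, pow_succ', ← hB]; congr 1; ring)
          omega
  refine ⟨hβ, ?_⟩
  exact map_one_eq_zero_of_annihilator hq hq_root φ (fun p => by rw [hφ]; simp [hβ]) hA

/-! ### The sequence of normalized partial sums -/

/-- The sequence `b_N = q ^ (N (N - 1) / 2) * (β₀ + ∑ₙ q ^ (-n (n - 1) / 2) ∑ᵢ βᵢ γᵢ ^ n)`, where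
`n` runs over `n < N`: the partial sums of `β₀ + ∑ᵢ βᵢ T_q(γᵢ)`, multiplied by the inverse of the
coefficient of `z ^ N` in `T_q`. It is defined by the recurrence which it satisfies. -/
noncomputable def scaledPartialSum {K : Type*} [Field K] {m : ℕ} (q β₀ : K) (γ β : Fin m → K) :
    ℕ → K
  | 0 => β₀
  | N + 1 => q ^ N * (scaledPartialSum q β₀ γ β N + ∑ i, β i * γ i ^ N)

theorem momentFunctional_scaledPartialSum_X_mul {K : Type*} [Field K] {m : ℕ} (q β₀ : K)
    (γ β : Fin m → K) (p : K[X]) :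
    momentFunctional (scaledPartialSum q β₀ γ β) (X * p) =
      momentFunctional (scaledPartialSum q β₀ γ β) (p.comp (C q * X))
        + ∑ i, β i * p.eval (q * γ i) := by
  induction p using Polynomial.induction_on' with
  | add p r hp hr =>
    rw [mul_add, map_add, hp, hr, add_comp, map_add]
    simp only [eval_add, mul_add, Finset.sum_add_distrib]
    ring
  | monomial n a =>
    rw [X_mul_monomial, momentFunctional_monomial, scaledPartialSum, ← C_mul_X_pow_eq_monomial,
      mul_comp, C_comp, X_pow_comp, mul_pow, ← C_pow, ← mul_assoc (C a), ← C_mul,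
      C_mul_X_pow_eq_monomial, momentFunctional_monomial]
    simp only [eval_mul, eval_C, eval_pow, eval_X, mul_add, Finset.mul_sum]
    congr 1
    · ring
    · exact Finset.sum_congr rfl fun i _ => by ring

theorem exists_bound_scaledPartialSum_of_le_one {K : Type*} [Field K] {m : ℕ} (q β₀ : K)
    (γ β : Fin m → K) (v : AbsoluteValue K ℝ) (hv : v q ≤ 1) :
    ∃ C : ℝ, 1 ≤ C ∧ ∀ N, v (scaledPartialSum q β₀ γ β N) ≤ C ^ (N + 1) := by
  have h0 : ∀ x, 0 ≤ v x := v.nonneg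
  have hβ : 0 ≤ ∑ i, v (β i) := Finset.sum_nonneg fun i _ => h0 _
  have hγ : 0 ≤ ∑ i, v (γ i) := Finset.sum_nonneg fun i _ => h0 _
  set C := 2 + v β₀ + ∑ i, v (β i) + ∑ i, v (γ i) with hC
  have hC2 : 2 ≤ C := by linarith [h0 β₀]
  refine ⟨C, by linarith, fun N => ?_⟩
  induction N with
  | zero =>
    rw [scaledPartialSum, zero_add, pow_one]
    linarith
  | succ N ih =>
    have hsum : v (∑ i, β i * γ i ^ N) ≤ C * C ^ N := by
      calc v (∑ i, β i * γ i ^ N) ≤ ∑ i, v (β i * γ i ^ N) := v.sum_le _ _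
        _ ≤ ∑ i, v (β i) * C ^ N := by
          refine Finset.sum_le_sum fun i _ => ?_
          rw [v.map_mul, v.map_pow]
          refine mul_le_mul_of_nonneg_left (pow_le_pow_left₀ (h0 _) ?_ N) (h0 _)
          have := Finset.single_le_sum (fun i _ => h0 (γ i)) (Finset.mem_univ i)
          linarith [h0 β₀]
        _ = (∑ i, v (β i)) * C ^ N := by rw [Finset.sum_mul]
        _ ≤ C * C ^ N := by
          refine mul_le_mul_of_nonneg_right ?_ (by positivity)
          linarith [h0 β₀]
    rw [scaledPartialSum, v.map_mul, v.map_pow]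
    calc v q ^ N * v (scaledPartialSum q β₀ γ β N + ∑ i, β i * γ i ^ N)
        ≤ 1 * (v (scaledPartialSum q β₀ γ β N) + v (∑ i, β i * γ i ^ N)) :=
          mul_le_mul (pow_le_one₀ (h0 _) hv) (v.add_le _ _) (h0 _) zero_le_one
      _ ≤ C ^ (N + 1) + C * C ^ N := by linarith
      _ = 2 * C ^ (N + 1) := by ring
      _ ≤ C * C ^ (N + 1) := mul_le_mul_of_nonneg_right hC2 (by positivity)
      _ = C ^ (N + 1 + 1) := by ring

theorem tschakaloffCoeff_succ {L : Type*} [Field L] (q : L) (n : ℕ) :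
    tschakaloffCoeff q (n + 1) = q⁻¹ ^ n * tschakaloffCoeff q n := by
  have step : (n + 1) * (n + 1 - 1) / 2 = n * (n - 1) / 2 + n := by
    rw [← Nat.choose_two_right, ← Nat.choose_two_right, Nat.choose_succ_succ' n 1]
    simp [add_comm]
  rw [tschakaloffCoeff, tschakaloffCoeff, step, pow_add, mul_inv, inv_pow, mul_comm]

theorem tschakaloff_mul_self {L : Type*} [NormedField L] [CompleteSpace L] (q z : L)
    (hq : 1 < ‖q‖) : tschakaloff q (q * z) = 1 + q * z * tschakaloff q z := by
  have hq0 : q ≠ 0 := norm_pos_iff.1 (one_pos.trans hq)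
  rw [tschakaloff, (summable_tschakaloff q (q * z) hq).tsum_eq_zero_add, tschakaloff,
    ← tsum_mul_left]
  congr 1
  · simp [tschakaloffCoeff]
  · refine tsum_congr fun n => ?_
    rw [tschakaloffCoeff_succ, mul_pow, inv_pow]
    field_simp
    ring

theorem norm_tschakaloff_le {L : Type*} [NormedField L] [CompleteSpace L] {q z : L} {r : ℝ}
    (hq : 1 < ‖q‖) (hz : ‖z‖ ≤ r) : ‖tschakaloff q z‖ ≤ tschakaloff ‖q‖ r := by
  refine tsum_of_norm_bounded
    (summable_tschakaloff (L := ℝ) ‖q‖ r (by simpa using hq)).hasSum fun n => ?_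
  rw [norm_mul, norm_pow, tschakaloffCoeff, tschakaloffCoeff, norm_inv, norm_pow]
  gcongr

/-- At a place where `|q| > 1` and the linear form vanishes, the partial sums are the negatives of
the tails: `b_N = - ∑ᵢ βᵢ γᵢ ^ N T_q(γᵢ q ^ (-N))`. -/
theorem toCompletion_scaledPartialSum {K : Type*} [Field K] {m : ℕ} (q β₀ : K)
    (γ β : Fin m → K) (v : AbsoluteValue K ℝ) (hv : 1 < v q)
    (h : toCompletion v β₀ +
      ∑ i, toCompletion v (β i) * tschakaloff (toCompletion v q) (toCompletion v (γ i)) = 0)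
    (N : ℕ) :
    toCompletion v (scaledPartialSum q β₀ γ β N) =
      -∑ i, toCompletion v (β i) * toCompletion v (γ i) ^ N *
        tschakaloff (toCompletion v q) (toCompletion v (γ i) * (toCompletion v q)⁻¹ ^ N) := by
  have hQ : 1 < ‖toCompletion v q‖ := by rwa [norm_toCompletion]
  have hQ0 : toCompletion v q ≠ 0 := norm_pos_iff.1 (one_pos.trans hQ)
  induction N with
  | zero =>
    simp only [pow_zero, mul_one, scaledPartialSum]
    exact eq_neg_of_add_eq_zero_left h
  | succ N ih =>
    rw [scaledPartialSum, map_mul, map_pow, map_add, ih, map_sum, neg_add_eq_sub,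
      ← Finset.sum_sub_distrib, Finset.mul_sum, ← Finset.sum_neg_distrib]
    refine Finset.sum_congr rfl fun i _ => ?_
    have hz : toCompletion v (γ i) * (toCompletion v q)⁻¹ ^ N =
        toCompletion v q * (toCompletion v (γ i) * (toCompletion v q)⁻¹ ^ (N + 1)) := by
      rw [pow_succ]
      field_simp
    rw [hz, tschakaloff_mul_self _ _ hQ, ← hz, map_mul, map_pow]
    have hpow : toCompletion v q ^ N * (toCompletion v q)⁻¹ ^ N = 1 := by
      rw [← mul_pow, mul_inv_cancel₀ hQ0, one_pow]
    linear_combination (-toCompletion v (β i) * toCompletion v (γ i) ^ (N + 1) *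
      tschakaloff (toCompletion v q)
        (toCompletion v (γ i) * (toCompletion v q)⁻¹ ^ (N + 1))) * hpow

theorem exists_bound_scaledPartialSum_of_one_lt {K : Type*} [Field K] {m : ℕ} (q β₀ : K)
    (γ β : Fin m → K) (v : AbsoluteValue K ℝ) (hv : 1 < v q)
    (h : toCompletion v β₀ +
      ∑ i, toCompletion v (β i) * tschakaloff (toCompletion v q) (toCompletion v (γ i)) = 0) :
    ∃ C : ℝ, 1 ≤ C ∧ ∀ N, v (scaledPartialSum q β₀ γ β N) ≤ C ^ (N + 1) := by
  have h0 : ∀ x, 0 ≤ v x := v.nonneg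
  have hQ : 1 < ‖toCompletion v q‖ := by rwa [norm_toCompletion]
  let S : Fin m → ℝ := fun i => tschakaloff (v q) (v (γ i))
  have hT : ∀ i N, ‖tschakaloff (toCompletion v q)
      (toCompletion v (γ i) * (toCompletion v q)⁻¹ ^ N)‖ ≤ S i := by
    intro i N
    have := norm_tschakaloff_le (z := toCompletion v (γ i) * (toCompletion v q)⁻¹ ^ N)
      (r := v (γ i)) hQ ?_
    · rwa [norm_toCompletion] at this
    · rw [norm_mul, norm_toCompletion, norm_pow, norm_inv, norm_toCompletion]
      exact mul_le_of_le_one_right (h0 _)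
        (pow_le_one₀ (inv_nonneg.2 (h0 _)) (inv_le_one_of_one_le₀ hv.le))
  have hS : ∀ i, 0 ≤ S i := fun i => (norm_nonneg _).trans (hT i 0)
  have hγ : 0 ≤ ∑ i, v (γ i) := Finset.sum_nonneg fun i _ => h0 _
  have hβS : 0 ≤ ∑ i, v (β i) * S i := Finset.sum_nonneg fun i _ => mul_nonneg (h0 _) (hS i)
  set C := 1 + ∑ i, v (β i) * S i + ∑ i, v (γ i) with hC
  refine ⟨C, by linarith, fun N => ?_⟩
  rw [← norm_toCompletion v, toCompletion_scaledPartialSum q β₀ γ β v hv h, norm_neg]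
  calc _ ≤ ∑ i, v (β i) * S i * C ^ N := by
        refine norm_sum_le_of_le _ fun i _ => ?_
        rw [norm_mul, norm_mul, norm_pow, norm_toCompletion, norm_toCompletion]
        have h1 : v (γ i) ^ N ≤ C ^ N := by
          refine pow_le_pow_left₀ (h0 _) ?_ N
          have := Finset.single_le_sum (fun i _ => h0 (γ i)) (Finset.mem_univ i)
          linarith
        calc _ ≤ v (β i) * C ^ N * S i :=
              mul_le_mul (mul_le_mul_of_nonneg_left h1 (h0 _)) (hT i N) (norm_nonneg _)
                (mul_nonneg (h0 _) (by positivity))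
          _ = v (β i) * S i * C ^ N := by ring
    _ = (∑ i, v (β i) * S i) * C ^ N := by rw [Finset.sum_mul]
    _ ≤ C * C ^ N := mul_le_mul_of_nonneg_right (by linarith) (by positivity)
    _ = C ^ (N + 1) := by ring

/-! ### Local estimates of the Hankel determinants -/

theorem factorial_le_two_pow_sq (n : ℕ) : (n.factorial : ℝ) ≤ 2 ^ (n ^ 2) := by
  have h1 : n.factorial ≤ 2 ^ (n ^ 2) := by
    calc n.factorial ≤ n ^ n := Nat.factorial_le_pow n
      _ ≤ (2 ^ n) ^ n := Nat.pow_le_pow_left Nat.lt_two_pow_self.le n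
      _ = 2 ^ (n ^ 2) := by rw [← pow_mul, sq]
  exact_mod_cast h1

theorem abv_det_le_of_le_mul_pow {K : Type*} [Field K] (v : AbsoluteValue K ℝ) {n : ℕ}
    (M : Matrix (Fin n) (Fin n) K) {E a c : ℝ}
    (h : ∀ i j, v (M i j) ≤ E * a ^ (i : ℕ) * c ^ (j : ℕ)) :
    v M.det ≤ n.factorial * (E ^ n * (a * c) ^ (n * (n - 1) / 2)) := by
  have hprod : ∀ x : ℝ, ∏ i : Fin n, x ^ (i : ℕ) = x ^ (n * (n - 1) / 2) := by
    intro x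
    rw [Finset.prod_pow_eq_pow_sum, ← Finset.sum_range_id, Finset.sum_range]
  calc v M.det = v (∑ σ : Equiv.Perm (Fin n), Equiv.Perm.sign σ • ∏ i, M (σ i) i) := by
        rw [Matrix.det_apply]
    _ ≤ ∑ σ : Equiv.Perm (Fin n), v (Equiv.Perm.sign σ • ∏ i, M (σ i) i) := v.sum_le _ _
    _ ≤ ∑ σ : Equiv.Perm (Fin n), E ^ n * (a * c) ^ (n * (n - 1) / 2) := by
        refine Finset.sum_le_sum fun σ _ => ?_
        rw [v.map_units_int_smul, map_prod]
        calc ∏ i, v (M (σ i) i) ≤ ∏ i, (E * a ^ (σ i : ℕ) * c ^ (i : ℕ)) :=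
              Finset.prod_le_prod (fun _ _ => v.nonneg _) fun i _ => h _ _
          _ = E ^ n * (a * c) ^ (n * (n - 1) / 2) := by
              rw [Finset.prod_mul_distrib, Finset.prod_mul_distrib,
                Equiv.prod_comp σ fun i => a ^ (i : ℕ), hprod, hprod, mul_pow, mul_assoc]
              simp
    _ = _ := by
        rw [Finset.sum_const, Finset.card_univ, Fintype.card_perm, Fintype.card_fin, nsmul_eq_mul]

theorem abv_det_hankelMatrix_le {K : Type*} [Field K] (v : AbsoluteValue K ℝ) (φ : K[X] →ₗ[K] K)
    {B : ℝ} (hB : ∀ n, v (φ (X ^ n)) ≤ B ^ (n + 1)) (n : ℕ) :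
    v (hankelMatrix φ n).det ≤ (2 * B) ^ (n ^ 2) := by
  have hB0 : 0 ≤ B := by simpa using (v.nonneg _).trans (hB 0)
  calc _ ≤ n.factorial * (B ^ n * (B * B) ^ (n * (n - 1) / 2)) := by
        refine abv_det_le_of_le_mul_pow v _ fun i j => ?_
        refine (hB _).trans_eq ?_
        ring
    _ = n.factorial * B ^ (n ^ 2) := by
        rw [← sq, ← pow_mul, Nat.mul_div_cancel' (Nat.even_mul_pred_self n).two_dvd, ← pow_add]
        congr 2
        rcases n with _ | n
        · rfl
        · simp only [Nat.add_sub_cancel]; ring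
    _ ≤ 2 ^ (n ^ 2) * B ^ (n ^ 2) :=
        mul_le_mul_of_nonneg_right (factorial_le_two_pow_sq n) (by positivity)
    _ = (2 * B) ^ (n ^ 2) := (mul_pow _ _ _).symm

theorem exists_bound_X_pow_mul {K : Type*} [Field K] (v : AbsoluteValue K ℝ) (φ : K[X] →ₗ[K] K)
    {p : K[X]} {E R : ℝ} (h : ∀ M : ℕ, v (φ (X ^ M * p)) ≤ E * R ^ M) (g : K[X]) :
    ∃ E', ∀ M : ℕ, v (φ (X ^ M * (g * p))) ≤ E' * R ^ M := by
  induction g using Polynomial.induction_on' with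
  | add g₁ g₂ h₁ h₂ =>
    obtain ⟨E₁, h₁⟩ := h₁
    obtain ⟨E₂, h₂⟩ := h₂
    refine ⟨E₁ + E₂, fun M => ?_⟩
    rw [add_mul, mul_add, map_add, add_mul]
    exact (v.add_le _ _).trans (add_le_add (h₁ M) (h₂ M))
  | monomial n a =>
    refine ⟨v a * (E * R ^ n), fun M => ?_⟩
    have : X ^ M * (monomial n a * p) = a • (X ^ (M + n) * p) := by
      rw [← C_mul_X_pow_eq_monomial, smul_eq_C_mul]
      ring
    rw [this, map_smul, smul_eq_mul, v.map_mul, mul_assoc, mul_assoc, ← pow_add, add_comm n]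
    exact mul_le_mul_of_nonneg_left (h _) (v.nonneg _)

/-- At a place where `|q| < 1`, iterating the `q`-difference equation continues the generating
series of the moments to a meromorphic function on the whole plane: for every ratio there is a
monic `p` such that the moments of `g ↦ φ (g * p)` decay like a geometric sequence of that ratio. -/
theorem exists_monic_forall_abv_le {K : Type*} [Field K] {m : ℕ} {q : K} {δ β : Fin m → K}
    (hq : q ≠ 0) (v : AbsoluteValue K ℝ) (φ : K[X] →ₗ[K] K)
    (hφ : ∀ p : K[X], φ (X * p) = φ (p.comp (C q * X)) + ∑ i, β i * p.eval (δ i))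
    {B : ℝ} (hB : ∀ n, v (φ (X ^ n)) ≤ B ^ (n + 1)) (k : ℕ) :
    ∃ p : K[X], p.Monic ∧ ∃ E : ℝ, ∀ M : ℕ, v (φ (X ^ M * p)) ≤ E * (v q ^ k * B) ^ M := by
  suffices h : ∃ p : K[X], p ≠ 0 ∧ ∃ E : ℝ, ∀ M : ℕ, v (φ (X ^ M * p)) ≤ E * (v q ^ k * B) ^ M by
    obtain ⟨p, hp, E, hE⟩ := h
    obtain ⟨E', hE'⟩ := exists_bound_X_pow_mul v φ hE (C p.leadingCoeff⁻¹)
    refine ⟨p * C p.leadingCoeff⁻¹, monic_mul_leadingCoeff_inv hp, E', fun M => ?_⟩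
    rw [mul_comm p]
    exact hE' M
  induction k with
  | zero =>
    refine ⟨1, one_ne_zero, B, fun M => ?_⟩
    rw [mul_one, pow_zero, one_mul, ← pow_succ']
    exact hB M
  | succ k ih =>
    obtain ⟨p, hp, E, hE⟩ := ih
    have hcomp : (p.comp (C q⁻¹ * X)).comp (C q * X) = p := by
      rw [comp_assoc, mul_comp, C_comp, X_comp, ← mul_assoc, ← C_mul, inv_mul_cancel₀ hq, C_1,
        one_mul, comp_X]
    -- `D` kills the inhomogeneous term of the equation
    let D : K[X] := ∏ i, (X - C (δ i))
    have hD : D ≠ 0 := Finset.prod_ne_zero_iff.2 fun i _ => X_sub_C_ne_zero _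
    obtain ⟨E', hE'⟩ := exists_bound_X_pow_mul v φ hE (D.comp (C q * X))
    refine ⟨X * (D * p.comp (C q⁻¹ * X)), ?_, E', fun M => ?_⟩
    · refine mul_ne_zero X_ne_zero (mul_ne_zero hD fun h0 => hp ?_)
      rw [← hcomp, h0, zero_comp]
    · have h1 : φ (X ^ M * (X * (D * p.comp (C q⁻¹ * X)))) =
          q ^ M * φ (X ^ M * (D.comp (C q * X) * p)) := by
        rw [mul_left_comm, hφ, Finset.sum_eq_zero, add_zero, mul_comp, mul_comp, hcomp,
          X_pow_comp, mul_pow, ← C_pow, mul_assoc, ← smul_eq_C_mul, map_smul, smul_eq_mul]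
        intro i _
        have : D.eval (δ i) = 0 := by
          rw [eval_prod]
          exact Finset.prod_eq_zero (Finset.mem_univ i) (by simp)
        rw [eval_mul, eval_mul, this, zero_mul, mul_zero, mul_zero]
      rw [h1, v.map_mul, v.map_pow]
      calc v q ^ M * v (φ (X ^ M * (D.comp (C q * X) * p)))
          ≤ v q ^ M * (E' * (v q ^ k * B) ^ M) :=
            mul_le_mul_of_nonneg_left (hE' M) (pow_nonneg (v.nonneg _) _)
        _ = E' * (v q ^ (k + 1) * B) ^ M := by
            rw [pow_succ, mul_pow, mul_pow, mul_pow]; ring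

/-- At a place where `|q| < 1`, the Hankel determinants tend to zero faster than `ε ^ (n ^ 2)` for
every `ε > 0`. -/
theorem eventually_abv_det_hankelMatrix_le {K : Type*} [Field K] {m : ℕ} {q : K}
    {δ β : Fin m → K} (hq : q ≠ 0) (v : AbsoluteValue K ℝ) (hv : v q < 1) (φ : K[X] →ₗ[K] K)
    (hφ : ∀ p : K[X], φ (X * p) = φ (p.comp (C q * X)) + ∑ i, β i * p.eval (δ i))
    {B : ℝ} (hB1 : 1 ≤ B) (hB : ∀ n, v (φ (X ^ n)) ≤ B ^ (n + 1)) {ε : ℝ} (hε : 0 < ε) :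
    ∀ᶠ n : ℕ in Filter.atTop, v (hankelMatrix φ n).det ≤ ε ^ (n ^ 2) := by
  have hB0 : 0 < B := by linarith
  have hvq : 0 < v q := v.pos hq
  set s := ε / 4 with hs
  have hs0 : 0 < s := by positivity
  obtain ⟨k, hk⟩ := exists_pow_lt_of_lt_one (y := v q) (x := min (s ^ 2 / B) 1 / B)
    (by positivity) hv
  obtain ⟨p, hp, E, hE⟩ := exists_monic_forall_abv_le hq v φ hφ hB k
  set R := v q ^ k * B with hR
  have hR0 : 0 < R := by positivity
  have hRlt : R < min (s ^ 2 / B) 1 := (lt_div_iff₀ hB0).1 hk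
  have hR1 : R ≤ 1 := (hRlt.trans_le (min_le_right _ _)).le
  have hRB : R * B ≤ s ^ 2 := (le_div_iff₀ hB0).1 (hRlt.trans_le (min_le_left _ _)).le
  have hE0 : 0 ≤ E := by simpa using (v.nonneg _).trans (hE 0)
  set d := p.natDegree with hd
  set F := (E + B ^ (d + 1)) * R⁻¹ ^ d with hF
  have hF0 : 0 < F := by positivity
  obtain ⟨n₀, hn₀⟩ := pow_unbounded_of_one_lt (F / s) (one_lt_two (α := ℝ))
  filter_upwards [Filter.eventually_ge_atTop n₀] with n hn
  -- all rows but the first `d` can be taken to be multiples of `p`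
  let f : Fin n → K[X] := fun i => if (i : ℕ) < d then X ^ (i : ℕ) else X ^ ((i : ℕ) - d) * p
  have hfm : ∀ i, (f i).Monic := by
    intro i
    simp only [f]
    split_ifs
    · exact monic_X_pow _
    · exact (monic_X_pow _).mul hp
  have hfd : ∀ i, (f i).natDegree = i := by
    intro i
    simp only [f]
    split_ifs with h
    · exact natDegree_X_pow _
    · rw [(monic_X_pow _).natDegree_mul hp, natDegree_X_pow]
      omega
  rw [det_hankelMatrix_eq_of_monic φ f hfm hfd]
  have hentry : ∀ i j : Fin n, v (φ (f i * X ^ (j : ℕ))) ≤ F * R ^ (i : ℕ) * B ^ (j : ℕ) := by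
    intro i j
    simp only [f]
    split_ifs with h
    · rw [← pow_add]
      calc _ ≤ B ^ ((i : ℕ) + j + 1) := hB _
        _ = B ^ ((i : ℕ) + 1) * B ^ (j : ℕ) := by ring
        _ ≤ F * R ^ (i : ℕ) * B ^ (j : ℕ) := by
          refine mul_le_mul_of_nonneg_right ?_ (by positivity)
          have h1 : R⁻¹ ^ d * R ^ (i : ℕ) = R⁻¹ ^ (d - i) := by
            rw [← Nat.sub_add_cancel h.le, pow_add, mul_assoc, ← mul_pow,
              inv_mul_cancel₀ hR0.ne', one_pow, mul_one, Nat.add_sub_cancel]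
          have h2 : 1 ≤ R⁻¹ ^ (d - i) := one_le_pow₀ (one_le_inv₀ hR0 |>.2 hR1)
          have h3 : B ^ ((i : ℕ) + 1) ≤ B ^ (d + 1) := pow_le_pow_right₀ hB1 (by omega)
          rw [hF, mul_assoc, h1]
          calc B ^ ((i : ℕ) + 1) ≤ (E + B ^ (d + 1)) * 1 := by linarith
            _ ≤ _ := mul_le_mul_of_nonneg_left h2 (by positivity)
    · have hid : d ≤ i := not_lt.1 h
      rw [mul_right_comm, ← pow_add]
      calc _ ≤ E * R ^ ((i : ℕ) - d + j) := hE _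
        _ = E * R⁻¹ ^ d * R ^ (i : ℕ) * R ^ (j : ℕ) := by
          rw [pow_add, inv_pow, pow_sub₀ _ hR0.ne' hid]
          ring
        _ ≤ F * R ^ (i : ℕ) * B ^ (j : ℕ) := by
          have h1 : E * R⁻¹ ^ d ≤ F :=
            mul_le_mul_of_nonneg_right (by linarith [pow_pos hB0 (d + 1)]) (by positivity)
          have h2 : R ^ (j : ℕ) ≤ B ^ (j : ℕ) := pow_le_pow_left₀ hR0.le (hR1.trans hB1) _
          exact mul_le_mul (mul_le_mul_of_nonneg_right h1 (by positivity)) h2 (by positivity)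
            (by positivity)
  have hFn : F ^ n ≤ 2 ^ (n ^ 2) * s ^ n := by
    have h1 : F / s ≤ 2 ^ n := hn₀.le.trans (pow_le_pow_right₀ one_le_two hn)
    have h2 := pow_le_pow_left₀ (by positivity) h1 n
    rwa [div_pow, div_le_iff₀ (by positivity), ← pow_mul, ← sq] at h2
  calc _ ≤ n.factorial * (F ^ n * (R * B) ^ (n * (n - 1) / 2)) :=
        abv_det_le_of_le_mul_pow v _ fun i j => hentry i j
    _ ≤ 2 ^ (n ^ 2) * ((2 ^ (n ^ 2) * s ^ n) * (s ^ 2) ^ (n * (n - 1) / 2)) := by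
        gcongr
        exact factorial_le_two_pow_sq n
    _ = ε ^ (n ^ 2) := by
        have h1 : s ^ n * (s ^ 2) ^ (n * (n - 1) / 2) = s ^ (n ^ 2) := by
          rw [← pow_mul, Nat.mul_div_cancel' (Nat.even_mul_pred_self n).two_dvd, ← pow_add]
          congr 1
          rcases n with _ | n
          · rfl
          · simp only [Nat.add_sub_cancel]; ring
        rw [mul_assoc, h1, ← mul_assoc, ← mul_pow, ← mul_pow, hs]
        congr 1
        ring

/-! ### Places of a number field -/

/-- A nonzero element which is not a root of unity has absolute value less than `1` at some
place. -/
theorem exists_place_lt_one {K : Type*} [Field K] [NumberField K] {q : K} (hq : q ≠ 0)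
    (hq_root : ∀ n : ℕ, 0 < n → q ^ n ≠ 1) :
    (∃ w : NumberField.InfinitePlace K, w q < 1) ∨ ∃ w : NumberField.FinitePlace K, w q < 1 := by
  by_contra! hcon
  obtain ⟨hinf, hfin⟩ := hcon
  have hint : IsIntegral ℤ q⁻¹ := by
    have hmem : q⁻¹ ∈ (algebraMap (NumberField.RingOfIntegers K) K).range := by
      refine IsDedekindDomain.HeightOneSpectrum.mem_integers_of_valuation_le_one K _ fun v => ?_
      have h1 : NumberField.FinitePlace.mk v q⁻¹ ≤ 1 := by
        rw [map_inv₀]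
        exact inv_le_one_of_one_le₀ (hfin _)
      rw [NumberField.FinitePlace.mk_apply, NumberField.FinitePlace.norm_embedding,
        NumberField.HeightOneSpectrum.adicAbv_def] at h1
      exact (WithZeroMulInt.toNNReal_le_one_iff
        (NumberField.HeightOneSpectrum.one_lt_absNorm_nnreal v)).1
          (by exact_mod_cast h1)
    obtain ⟨y, hy⟩ := hmem
    rw [← hy]
    exact NumberField.RingOfIntegers.isIntegral_coe y
  obtain ⟨n, hn, h⟩ := NumberField.Embeddings.pow_eq_one_of_norm_le_one K ℂ (inv_ne_zero hq) hint
    fun φ => by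
      rw [← NumberField.InfinitePlace.apply, map_inv₀]
      exact inv_le_one_of_one_le₀ (hinf _)
  exact hq_root n hn (by rwa [inv_pow, inv_eq_one] at h)

theorem finite_setOf_one_lt_finitePlace {K : Type*} [Field K] [NumberField K] (x : K) :
    {w : NumberField.FinitePlace K | 1 < w x}.Finite := by
  by_cases hx : x = 0
  · simp [hx, not_lt.2 (zero_le_one (α := ℝ))]
  · exact (NumberField.FinitePlace.hasFiniteMulSupport hx).subset fun w hw => ne_of_gt hw

/-- The ring of elements of `K` which are integral at a finite place. -/
noncomputable def finitePlaceSubring {K : Type*} [Field K] [NumberField K]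
    (w : NumberField.FinitePlace K) : Subring K where
  carrier := {x | w x ≤ 1}
  mul_mem' {x y} hx hy := by
    rw [Set.mem_ofPred_eq, map_mul]
    exact mul_le_one₀ hx (apply_nonneg w y) hy
  one_mem' := by simp
  add_mem' {x y} hx hy := (NumberField.FinitePlace.add_le w x y).trans (max_le hx hy)
  zero_mem' := by simp
  neg_mem' {x} hx := by
    rw [Set.mem_ofPred_eq, map_neg_eq_map]
    exact hx

theorem mem_finitePlaceSubring {K : Type*} [Field K] [NumberField K]
    {w : NumberField.FinitePlace K} {x : K} : x ∈ finitePlaceSubring w ↔ w x ≤ 1 :=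
  Iff.rfl

theorem finite_setOf_scaledPartialSum_not_integral {K : Type*} [Field K] [NumberField K] {m : ℕ}
    (q β₀ : K) (γ β : Fin m → K) :
    {w : NumberField.FinitePlace K | ¬ ∀ N, w (scaledPartialSum q β₀ γ β N) ≤ 1}.Finite := by
  have hfin : ({w : NumberField.FinitePlace K | 1 < w q} ∪ {w | 1 < w β₀} ∪
      ((⋃ i, {w | 1 < w (γ i)}) ∪ ⋃ i, {w | 1 < w (β i)})).Finite :=
    ((finite_setOf_one_lt_finitePlace q).union (finite_setOf_one_lt_finitePlace β₀)).union
      ((Set.finite_iUnion fun i => finite_setOf_one_lt_finitePlace (γ i)).union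
        (Set.finite_iUnion fun i => finite_setOf_one_lt_finitePlace (β i)))
  refine hfin.subset fun w hw => ?_
  by_contra hcon
  simp only [Set.mem_union, Set.mem_iUnion, Set.mem_ofPred_eq, not_or, not_exists, not_lt] at hcon
  obtain ⟨⟨hq, hβ₀⟩, hγ, hβ⟩ := hcon
  refine hw fun N => ?_
  rw [← mem_finitePlaceSubring]
  induction N with
  | zero => exact hβ₀
  | succ N ih =>
    exact mul_mem (pow_mem (mem_finitePlaceSubring.2 hq) _) (add_mem ih (sum_mem fun i _ =>
      mul_mem (mem_finitePlaceSubring.2 (hβ i)) (pow_mem (mem_finitePlaceSubring.2 (hγ i)) _)))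

theorem finitePlace_det_hankelMatrix_le_one {K : Type*} [Field K] [NumberField K]
    {w : NumberField.FinitePlace K} {φ : K[X] →ₗ[K] K} (h : ∀ n : ℕ, w (φ (X ^ n)) ≤ 1) (n : ℕ) :
    w (hankelMatrix φ n).det ≤ 1 := by
  rw [← mem_finitePlaceSubring, Matrix.det_apply]
  refine sum_mem fun σ _ => ?_
  rw [Units.smul_def]
  exact zsmul_mem (prod_mem fun i _ => h _) _

/-- The product formula in the form of Liouville's inequality. -/
theorem eq_zero_of_place_le_pow {K : Type*} [Field K] [NumberField K] {x : K} {n : ℕ} (hn : n ≠ 0)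
    (c : NumberField.InfinitePlace K → ℝ) (d : NumberField.FinitePlace K → ℝ)
    (hc0 : ∀ w, 0 ≤ c w) (hd0 : ∀ w, 0 ≤ d w) (hd : d.HasFiniteMulSupport)
    (hc : ∀ w : NumberField.InfinitePlace K, w x ≤ c w ^ n)
    (hdx : ∀ w : NumberField.FinitePlace K, w x ≤ d w ^ n)
    (hlt : (∏ w, c w ^ w.mult) * ∏ᶠ w, d w < 1) : x = 0 := by
  by_contra hx
  have hnonneg : 0 ≤ (∏ w, c w ^ w.mult) * ∏ᶠ w, d w :=
    mul_nonneg (Finset.prod_nonneg fun w _ => pow_nonneg (hc0 w) _) (finprod_nonneg hd0)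
  have hdn : (fun w => d w ^ n).HasFiniteMulSupport :=
    hd.subset fun w hw hw1 => hw (by simp only [hw1, one_pow])
  have h1 : (1 : ℝ) ≤ ((∏ w, c w ^ w.mult) * ∏ᶠ w, d w) ^ n := by
    rw [← NumberField.prod_abs_eq_one hx, mul_pow, finprod_pow hd, ← Finset.prod_pow]
    refine mul_le_mul ?_ ?_ (finprod_nonneg fun w => apply_nonneg w x)
      (Finset.prod_nonneg fun w _ => pow_nonneg (pow_nonneg (hc0 w) _) _)
    · refine Finset.prod_le_prod (fun w _ => pow_nonneg (apply_nonneg w x) _) fun w _ => ?_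
      rw [pow_right_comm]
      exact pow_le_pow_left₀ (apply_nonneg w x) (hc w) _
    · exact finprod_le_finprod (NumberField.FinitePlace.hasFiniteMulSupport hx)
        (fun w => apply_nonneg w x) hdn hdx
  exact absurd h1 (not_le.2 (pow_lt_one₀ hnonneg hlt hn))

/-- Global step: the local estimates contradict the product formula for a nonzero Hankel
determinant of large size, since a single place with `|q| < 1` outweighs all the others. -/
theorem eventually_det_hankelMatrix_eq_zero {K : Type*} [Field K] [NumberField K] {m : ℕ} {q : K}
    {δ β : Fin m → K} (hq : q ≠ 0) (hq_root : ∀ n : ℕ, 0 < n → q ^ n ≠ 1) (φ : K[X] →ₗ[K] K)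
    (hφ : ∀ p : K[X], φ (X * p) = φ (p.comp (C q * X)) + ∑ i, β i * p.eval (δ i))
    (hinf : ∀ w : NumberField.InfinitePlace K,
      ∃ B : ℝ, 1 ≤ B ∧ ∀ n, w (φ (X ^ n)) ≤ B ^ (n + 1))
    (hfin : ∀ w : NumberField.FinitePlace K,
      ∃ B : ℝ, 1 ≤ B ∧ ∀ n, w (φ (X ^ n)) ≤ B ^ (n + 1))
    (hint : {w : NumberField.FinitePlace K | ¬ ∀ n : ℕ, w (φ (X ^ n)) ≤ 1}.Finite) :
    ∀ᶠ n in Filter.atTop, (hankelMatrix φ n).det = 0 := by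
  classical
  choose B hB1 hB using hinf
  choose B' hB1' hB' using hfin
  let c : NumberField.InfinitePlace K → ℝ := fun w => 2 * B w
  let d : NumberField.FinitePlace K → ℝ := fun w =>
    if ∀ n : ℕ, w (φ (X ^ n)) ≤ 1 then 1 else 2 * B' w
  have hc1 : ∀ w, 1 ≤ c w := fun w => by simp only [c]; linarith [hB1 w]
  have hd1 : ∀ w, 1 ≤ d w := by
    intro w
    simp only [d]
    split_ifs
    · exact le_rfl
    · linarith [hB1' w]
  have hdsupp : d.HasFiniteMulSupport := hint.subset fun w hw h => hw (if_pos h)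
  have hcH : ∀ (w : NumberField.InfinitePlace K) n, w (hankelMatrix φ n).det ≤ c w ^ (n ^ 2) :=
    fun w n => abv_det_hankelMatrix_le w.1 φ (hB w) n
  have hdH : ∀ (w : NumberField.FinitePlace K) n, w (hankelMatrix φ n).det ≤ d w ^ (n ^ 2) := by
    intro w n
    simp only [d]
    split_ifs with h
    · rw [one_pow]
      exact finitePlace_det_hankelMatrix_le_one h n
    · exact abv_det_hankelMatrix_le w.1 φ (hB' w) n
  set P := (∏ w, c w ^ w.mult) * ∏ᶠ w, d w with hP
  have hP1 : 1 ≤ P := one_le_mul_of_one_le_of_one_le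
    (Finset.one_le_prod fun w _ => one_le_pow₀ (hc1 w)) (one_le_finprod hd1)
  -- the gain at one place which is needed to beat the contribution `P` of all places
  set ε := 1 / (2 * P) with hε
  have hε0 : 0 < ε := by positivity
  have hε1 : ε ≤ 1 := by
    rw [hε, div_le_one (by positivity)]
    linarith
  have hPε : P * ε < 1 := by
    rw [hε]
    field_simp
    norm_num
  rcases exists_place_lt_one hq hq_root with ⟨w, hw⟩ | ⟨w, hw⟩
  · filter_upwards [Filter.eventually_gt_atTop 0,
      eventually_abv_det_hankelMatrix_le hq w.1 hw φ hφ (hB1 w) (hB w) hε0] with n hn hnε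
    refine eq_zero_of_place_le_pow (n := n ^ 2) (by positivity)
      (fun v => c v * if v = w then ε else 1) d (fun v => ?_) (fun v => zero_le_one.trans (hd1 v))
      hdsupp (fun v => ?_) (fun v => hdH v n) ?_
    · exact mul_nonneg (zero_le_one.trans (hc1 v)) (by split_ifs <;> positivity)
    · split_ifs with h
      · subst h
        exact hnε.trans (pow_le_pow_left₀ hε0.le (le_mul_of_one_le_left hε0.le (hc1 _)) _)
      · rw [mul_one]
        exact hcH v n
    · simp only [mul_pow, ite_pow, one_pow]
      rw [Finset.prod_mul_distrib, Finset.prod_ite_eq' Finset.univ w, if_pos (Finset.mem_univ w),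
        mul_right_comm, ← hP]
      refine lt_of_le_of_lt (mul_le_mul_of_nonneg_left ?_ (by positivity)) hPε
      exact pow_le_of_le_one hε0.le hε1 w.mult_pos.ne'
  · filter_upwards [Filter.eventually_gt_atTop 0,
      eventually_abv_det_hankelMatrix_le hq w.1 hw φ hφ (hB1' w) (hB' w) hε0] with n hn hnε
    have hsupp : (fun v => if v = w then ε else 1).HasFiniteMulSupport :=
      (Set.finite_singleton w).subset fun v hv => by
        by_contra h
        exact hv (if_neg h)
    refine eq_zero_of_place_le_pow (n := n ^ 2) (by positivity) c
      (fun v => d v * if v = w then ε else 1) (fun v => zero_le_one.trans (hc1 v)) (fun v => ?_)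
      ?_ (fun v => hcH v n) (fun v => ?_) ?_
    · exact mul_nonneg (zero_le_one.trans (hd1 v)) (by split_ifs <;> positivity)
    · exact hdsupp.mul hsupp
    · split_ifs with h
      · subst h
        exact hnε.trans (pow_le_pow_left₀ hε0.le (le_mul_of_one_le_left hε0.le (hd1 _)) _)
      · rw [mul_one]
        exact hdH v n
    · rw [finprod_mul_distrib hdsupp hsupp, finprod_eq_single _ w fun v hv => if_neg hv,
        if_pos rfl, ← mul_assoc, ← hP]
      exact hPε

/-! ### Linear independence of the values -/

theorem mainTheorem6 {K : Type*} [Field K] [NumberField K] {m : ℕ}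
    (q ξ β₀ : K) (α β : Fin m → K)
    (hq : q ≠ 0) (hξ : ξ ≠ 0) (hα : ∀ i, α i ≠ 0)
    (hq_root : ∀ n : ℕ, 0 < n → q ^ n ≠ 1)
    (hα_classes : Function.Injective fun i =>
      (QuotientGroup.mk (Units.mk0 (α i) (hα i)) :
        Kˣ ⧸ Subgroup.zpowers (Units.mk0 q hq)))
    (hvanish : ∀ v : AbsoluteValue K ℝ,
      NumberField.IsInfinitePlace v ∨ NumberField.IsFinitePlace v → 1 < v q →
        tschakaloffComb v q α β₀ β (toCompletion v ξ) = 0) :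
    β₀ = 0 ∧ ∀ i, β i = 0 := by
  let γ : Fin m → K := fun i => α i * ξ
  let b := scaledPartialSum q β₀ γ β
  have hbound : ∀ v : AbsoluteValue K ℝ,
      NumberField.IsInfinitePlace v ∨ NumberField.IsFinitePlace v →
      ∃ B : ℝ, 1 ≤ B ∧ ∀ n, v (momentFunctional b (X ^ n)) ≤ B ^ (n + 1) := by
    intro v hv
    simp only [momentFunctional_X_pow]
    rcases le_or_gt (v q) 1 with h | h
    · exact exists_bound_scaledPartialSum_of_le_one q β₀ γ β v h
    · refine exists_bound_scaledPartialSum_of_one_lt q β₀ γ β v h ?_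
      have := hvanish v hv h
      simpa only [tschakaloffComb, γ, map_mul] using this
  have hφ := momentFunctional_scaledPartialSum_X_mul q β₀ γ β
  have hdet := eventually_det_hankelMatrix_eq_zero hq hq_root (momentFunctional b) hφ
    (fun w => hbound w.1 (Or.inl w.isInfinitePlace))
    (fun w => hbound w.1 (Or.inr w.isFinitePlace))
    (by
      simp only [momentFunctional_X_pow]
      exact finite_setOf_scaledPartialSum_not_integral q β₀ γ β)
  obtain ⟨hβ, h1⟩ := eq_zero_of_annihilator hq hq_root
    (fun i => mul_ne_zero hq (mul_ne_zero (hα i) hξ))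
    (fun i j k hk => by
      refine hα_classes (QuotientGroup.eq.2 (Subgroup.mem_zpowers_iff.2 ⟨k, Units.ext ?_⟩))
      have h2 : q * ξ * (α i * q ^ k) = q * ξ * α j := by linear_combination hk
      have h3 := mul_left_cancel₀ (mul_ne_zero hq hξ) h2
      simp only [Units.val_zpow_eq_zpow_val, Units.val_mk0, Units.val_mul, Units.val_inv_eq_inv_val]
      rw [← h3, inv_mul_cancel_left₀ (hα i)])
    (momentFunctional b) hφ (exists_annihilator_of_det_hankelMatrix _ hdet)
  refine ⟨?_, hβ⟩
  rw [← pow_zero X, momentFunctional_X_pow] at h1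
  exact h1
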